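/- Let $n\ge 1$. For a bounded measurable function $m$ on $\mathbb R^n\times\mathbb R^n$ and Schwartz functions $f,g\in\mathcal S(\mathbb R^n)$ (complex-valued) put $$M_m(f,g)(x)=\int_{\mathbb R^n}\int_{\mathbb R^n}\hat f(\xi)\,\hat g(\eta)\,m(\xi,\eta)\,e^{2\pi i x\cdot(\xi+\eta)}\,d\xi\,d\eta,\qquad \hat f(\xi)=\int_{\mathbb R^n}f(x)e^{-2\pi i x\cdot\xi}\,dx .$$ The function $m$ is called a bilinear multiplier for $(p,q,r)$ if there is a finite constant $C$ such that $\|M_m(f,g)\|_{L^r(\mathbb R^n)}\le C\|f\|_{L^p(\mathbb R^n)}\|g\|_{L^q(\mathbb R^n)}$ for all $f,g\in\mathcal S(\mathbb R^n)$. The local $L^2$-range is the set of triples $(p,q,r)$ of exponents with $\frac1p+\frac1q=\frac1r$ and $2\le p,q,r'\le\infty$, where $\frac1r+\frac1{r'}=1$ (with $\frac1\infty=0$). Then for every triple $(p,q,r)$ in the local $L^2$-range and every real $\lambda\neq0$, the function $e^{i\lambda|\xi-\eta|^2}$ is not a bilinear multiplier for $(p,q,r)$. In particular ($\lambda=1$),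 $e^{i|\xi-\eta|^2}$ is not a bilinear multiplier for any triple in the local $L^2$-range. -/

import Mathlib

open MeasureTheory
open scoped FourierTransform SchwartzMap ENNReal NNReal

noncomputable section

/-- The bilinear operator with symbol `m`:
`M_m(f,g)(x) = ∫∫ f̂(ξ) ĝ(η) m(ξ,η) e^{2πi x·(ξ+η)} dξ dη`, where
`f̂(ξ) = ∫ f(x) e^{-2πi x·ξ} dx`. -/
def bilinearMultiplierOp {n : ℕ}
    (m : EuclideanSpace ℝ (Fin n) → EuclideanSpace ℝ (Fin n) → ℂ)
    (f g : EuclideanSpace ℝ (Fin n) → ℂ) (x : EuclideanSpace ℝ (Fin n)) : ℂ :=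
  ∫ ξ : EuclideanSpace ℝ (Fin n), ∫ η : EuclideanSpace ℝ (Fin n),
    𝓕 f ξ * 𝓕 g η * m ξ η *
      Complex.exp (2 * (Real.pi : ℂ) * Complex.I * ((inner ℝ x (ξ + η) : ℝ) : ℂ))

/-- A bounded measurable symbol `m` is a bilinear multiplier for `(p,q,r)` if
`‖M_m(f,g)‖_r ≤ C ‖f‖_p ‖g‖_q` for all Schwartz functions `f`, `g`, with a finite constant `C`
independent of `f` and `g`. -/
def IsBilinearMultiplier {n : ℕ}
    (m : EuclideanSpace ℝ (Fin n) → EuclideanSpace ℝ (Fin n) → ℂ) (p q r : ℝ≥0∞) : Prop :=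
  Measurable (Function.uncurry m) ∧ (∃ B : ℝ, ∀ ξ η, ‖m ξ η‖ ≤ B) ∧
  ∃ C : ℝ≥0, ∀ f g : 𝓢(EuclideanSpace ℝ (Fin n), ℂ),
    eLpNorm (bilinearMultiplierOp m f g) r volume ≤
      (C : ℝ≥0∞) * eLpNorm f p volume * eLpNorm g q volume

/-- The local `L²`-range: `2 ≤ p, q, r' ≤ ∞` and `1/p + 1/q = 1/r`, where `r'` is the exponent
conjugate to `r`, that is `1/r + 1/r' = 1`. -/
def InLocalL2Range (p q r : ℝ≥0∞) : Prop :=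
  2 ≤ p ∧ 2 ≤ q ∧ (∃ r' : ℝ≥0∞, 1 / r + 1 / r' = 1 ∧ 2 ≤ r') ∧ 1 / p + 1 / q = 1 / r

/-- The symbol `e^{iλ|ξ-η|²}`. -/
def quadraticSymbol (n : ℕ) (lam : ℝ) (ξ η : EuclideanSpace ℝ (Fin n)) : ℂ :=
  Complex.exp (Complex.I * (lam : ℂ) * ((‖ξ - η‖ ^ 2 : ℝ) : ℂ))

/-- The symbol is measurable and has modulus one, so only the norm inequality is at stake in
`IsBilinearMultiplier`. -/
theorem quadraticSymbol_measurable_and_norm (n : ℕ) (lam : ℝ) :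
    Measurable (Function.uncurry (quadraticSymbol n lam)) ∧
      ∀ ξ η, ‖quadraticSymbol n lam ξ η‖ = 1 := by
  constructor
  · apply Continuous.measurable
    unfold Function.uncurry quadraticSymbol
    fun_prop
  · intro ξ η
    have h : Complex.I * (lam : ℂ) * ((‖ξ - η‖ ^ 2 : ℝ) : ℂ)
        = ((lam * ‖ξ - η‖ ^ 2 : ℝ) : ℂ) * Complex.I := by
      push_cast
      ring
    rw [quadraticSymbol, h, Complex.norm_exp_ofReal_mul_I]

end

/-! Write `lam = π μ` and test on `f = g = e^{-π|x|²/A}` with `A = ε + 2iμ`, so that `f̂` is a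
multiple of `e^{-πA|ξ|²}`. Since `2(|ξ|² + |η|²) = |ξ+η|² + |ξ-η|²`, the chirps of the two
transforms cancel the symbol in `ξ-η` and leave a chirp in `ξ+η` alone. The oscillation that kept
the `ξ-η` integral bounded is gone, and an exact computation gives `|M(f,f)| = (|A|/ε)^{n/2} |f|²`
(`norm_bilinearMultiplierOp_quadraticSymbol_gaussian`). All norms involved are those of dilated
fixed Gaussians, and by `1/p + 1/q = 1/r` the dilation factors cancel
(`quadraticSymbol_gaussian_bound`). Hence `(|A|/ε)^{n/2}` would be bounded, yet it blows up as `ε →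
0`. -/

/-! ### Complex Gaussians as Schwartz functions. -/

/-- Polynomials are dominated by Gaussians. -/
theorem exists_one_add_pow_mul_exp_neg_mul_sq_le {a : ℝ} (ha : 0 < a) (N : ℕ) :
    ∃ C : ℝ, ∀ r : ℝ, 0 ≤ r → (1 + r) ^ N * Real.exp (-a * r ^ 2) ≤ C := by
  refine ⟨2 ^ N * (N.factorial / a ^ N) * Real.exp a, fun r hr => ?_⟩
  have h1 : (1 + r) ^ N ≤ 2 ^ N * (1 + r ^ 2) ^ N := by
    rw [← mul_pow]
    gcongr
    nlinarith [sq_nonneg (r - 1)]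
  have h2 : (1 + r ^ 2) ^ N ≤ N.factorial / a ^ N * Real.exp (a * (1 + r ^ 2)) := by
    have h := Real.pow_div_factorial_le_exp (x := a * (1 + r ^ 2)) (by positivity) N
    rw [mul_pow, div_le_iff₀ (by positivity)] at h
    rw [div_mul_eq_mul_div, le_div_iff₀ (by positivity)]
    linarith
  calc (1 + r) ^ N * Real.exp (-a * r ^ 2)
      ≤ 2 ^ N * (N.factorial / a ^ N * Real.exp (a * (1 + r ^ 2))) * Real.exp (-a * r ^ 2) := by
        gcongr
        exact h1.trans (by gcongr)
    _ = 2 ^ N * (N.factorial / a ^ N) *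
          (Real.exp (a * (1 + r ^ 2)) * Real.exp (-a * r ^ 2)) := by ring
    _ = _ := by
        rw [← Real.exp_add]
        congr 2
        ring

theorem iteratedDeriv_cexp_mul_ofReal (c : ℂ) (i : ℕ) :
    iteratedDeriv i (fun t : ℝ => Complex.exp (c * t)) = fun t : ℝ => c ^ i * Complex.exp (c * t) := by
  induction i with
  | zero => simp
  | succ i ih =>
    rw [iteratedDeriv_succ, ih]
    ext t
    have h : HasDerivAt (fun t : ℝ => c ^ i * Complex.exp (c * t))
        (c ^ i * (Complex.exp (c * t) * (c * 1))) t :=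
      ((((hasDerivAt_id (t : ℂ)).const_mul c).cexp).comp_ofReal).const_mul (c ^ i)
    rw [h.deriv]
    ring

section Schwartz

variable {H : Type*} [NormedAddCommGroup H] [InnerProductSpace ℝ H]

theorem contDiff_cexp_mul_ofReal (c : ℂ) {k : WithTop ℕ∞} :
    ContDiff ℝ k (fun t : ℝ => Complex.exp (c * t)) :=
  (contDiff_const.mul Complex.ofRealCLM.contDiff).cexp

/-- The Gaussian `x ↦ e^{-b|x|²}` with `Re b > 0`, as a Schwartz function. -/
noncomputable def gaussianSchwartz (b : ℂ) (hb : 0 < b.re) : 𝓢(H, ℂ) where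
  toFun x := Complex.exp (-b * ‖x‖ ^ 2)
  smooth' := by
    have h := (contDiff_cexp_mul_ofReal (-b) (k := (⊤ : ℕ∞))).comp (contDiff_norm_sq ℝ (E := H))
    simpa [Function.comp_def] using h
  decay' := by
    intro k m
    obtain ⟨l, D, hD, hbd⟩ :=
      (Function.hasTemperateGrowth_norm_sq (H := H)).norm_iteratedFDeriv_le_uniform m
    -- The power collects the weight `(1 + |x|)^k` and the growth `(1 + |x|)^(l * m)` from the
    -- derivatives of `|x|²` in the chain rule.
    obtain ⟨C, hC⟩ := exists_one_add_pow_mul_exp_neg_mul_sq_le hb (k + l * m)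
    refine ⟨m.factorial * (1 + ‖b‖) ^ m * (1 + D) ^ m * C, fun x => ?_⟩
    have key : ‖iteratedFDeriv ℝ m
        ((fun t : ℝ => Complex.exp (-b * t)) ∘ fun x : H => ‖x‖ ^ 2) x‖ ≤
        m.factorial * ((1 + ‖b‖) ^ m * Real.exp (-b.re * ‖x‖ ^ 2)) *
          ((1 + D) * (1 + ‖x‖) ^ l) ^ m := by
      refine norm_iteratedFDeriv_comp_le (N := m) (contDiff_cexp_mul_ofReal (-b))
        (contDiff_norm_sq ℝ) le_rfl x (fun i hi => ?_) (fun i h1 hi => ?_)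
      · rw [norm_iteratedFDeriv_eq_norm_iteratedDeriv, iteratedDeriv_cexp_mul_ofReal]
        rw [norm_mul, norm_pow, norm_neg, Complex.norm_exp]
        have : (-b * ((‖x‖ ^ 2 : ℝ) : ℂ)).re = -b.re * ‖x‖ ^ 2 := by
          rw [Complex.re_mul_ofReal, Complex.neg_re]
        rw [this]
        gcongr
        calc ‖b‖ ^ i ≤ (1 + ‖b‖) ^ i := by gcongr; linarith
          _ ≤ (1 + ‖b‖) ^ m := pow_le_pow_right₀ (by linarith [norm_nonneg b]) hi
      -- The chain rule bound asks for an `i`-th power on the right; a base at least `1` allows this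
      -- for every `i ≥ 1`, hence `1 + D` rather than `D`.
      · have h1' : 1 ≤ (1 + D) * (1 + ‖x‖) ^ l :=
          one_le_mul_of_one_le_of_one_le (by linarith)
            (one_le_pow₀ (by linarith [norm_nonneg x]))
        calc _ ≤ D * (1 + ‖x‖) ^ l := hbd i hi x
          _ ≤ (1 + D) * (1 + ‖x‖) ^ l := by gcongr; linarith
          _ ≤ _ := le_self_pow₀ h1' (by lia)
    have e : (fun x : H => Complex.exp (-b * (‖x‖ : ℂ) ^ 2)) =
        (fun t : ℝ => Complex.exp (-b * t)) ∘ fun x : H => ‖x‖ ^ 2 := by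
      ext x
      simp
    rw [e]
    calc _ ≤ (1 + ‖x‖) ^ k * (m.factorial * ((1 + ‖b‖) ^ m * Real.exp (-b.re * ‖x‖ ^ 2)) *
          ((1 + D) * (1 + ‖x‖) ^ l) ^ m) := by
            gcongr
            linarith
      _ = m.factorial * (1 + ‖b‖) ^ m * (1 + D) ^ m *
          ((1 + ‖x‖) ^ (k + l * m) * Real.exp (-b.re * ‖x‖ ^ 2)) := by
            rw [mul_pow, pow_add, pow_mul]
            ring
      _ ≤ _ := by
            gcongr
            exact hC _ (norm_nonneg x)

theorem coe_gaussianSchwartz (b : ℂ) (hb : 0 < b.re) :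
    (gaussianSchwartz b hb : H → ℂ) = fun x => Complex.exp (-b * ‖x‖ ^ 2) := rfl

end Schwartz

theorem norm_cexp_mul_norm_sq {H : Type*} [NormedAddCommGroup H] (c : ℂ) (x : H) :
    ‖Complex.exp (c * (‖x‖ : ℂ) ^ 2)‖ = Real.exp (c.re * ‖x‖ ^ 2) := by
  rw [Complex.norm_exp, ← Complex.ofReal_pow, Complex.re_mul_ofReal]

/-- The `Lᵖ` norm of a dilated function. -/
theorem eLpNorm_comp_smul_eq {E F : Type*} [NormedAddCommGroup E] [NormedSpace ℝ E]
    [FiniteDimensional ℝ E] [MeasurableSpace E] [BorelSpace E] (μ : Measure E) [μ.IsAddHaarMeasure]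
    [NormedAddCommGroup F] (f : E → F) (p : ℝ≥0∞) {c : ℝ} (hc : c ≠ 0) :
    eLpNorm (fun x => f (c • x)) p μ =
      ENNReal.ofReal |(c ^ Module.finrank ℝ E)⁻¹| ^ (1 / p).toReal * eLpNorm f p μ := by
  have h := ((Homeomorph.smulOfNeZero (α := E) c hc).measurableEmbedding).eLpNorm_map_measure
    (g := f) (p := p) (μ := μ)
  have h2 : (⇑(Homeomorph.smulOfNeZero c hc) : E → E) = (c • ·) := rfl
  rw [h2, Measure.map_addHaar_smul μ hc, eLpNorm_smul_measure_of_ne_zero (by simp [hc])] at h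
  rw [smul_eq_mul] at h
  exact h.symm

/-! ### Exact evaluation on chirped Gaussians. -/

/-- The operator with symbol `e^{iπμ|ξ-η|²}` applied to a pair of equal chirped Gaussians. -/
theorem norm_bilinearMultiplierOp_quadraticSymbol_gaussian (n : ℕ) (ε μ : ℝ) (hε : 0 < ε)
    (A : ℂ) (hA : A = ε + 2 * μ * Complex.I) (x : EuclideanSpace ℝ (Fin n)) :
    ‖bilinearMultiplierOp (quadraticSymbol n (Real.pi * μ))
      (fun x => Complex.exp (-(Real.pi / A) * ‖x‖ ^ 2))
      (fun x => Complex.exp (-(Real.pi / A) * ‖x‖ ^ 2)) x‖ =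
    (‖A‖ / ε) ^ (n / 2 : ℝ) * ‖Complex.exp (-(2 * (Real.pi / A)) * ‖x‖ ^ 2)‖ := by
  have hπ : (0 : ℝ) < Real.pi := Real.pi_pos
  have hπ0 : (Real.pi : ℂ) ≠ 0 := Complex.ofReal_ne_zero.2 hπ.ne'
  have hε0 : (ε : ℂ) ≠ 0 := Complex.ofReal_ne_zero.2 hε.ne'
  have re_inv_pos : ∀ z : ℂ, 0 < z.re → 0 < (z⁻¹).re := fun z hz => by
    rw [Complex.inv_re]
    exact div_pos hz (Complex.normSq_pos.2 fun h => by simp [h] at hz)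
  have hAre : A.re = ε := by simp [hA]
  have hA0 : A ≠ 0 := fun h => by simp [h] at hAre; exact hε.ne hAre
  have hb : 0 < (Real.pi / A : ℂ).re := by
    rw [div_eq_mul_inv, Complex.re_ofReal_mul]
    exact mul_pos hπ (re_inv_pos A (hAre ▸ hε))
  -- `B = A - iμ` is the coefficient of `|ξ|²` and of `|η|²` once the symbol is expanded; its cross
  -- term turns `x` into `x - μξ` in the `η` integral.
  set B : ℂ := ε + μ * Complex.I with hB
  have hBre : B.re = ε := by simp [hB]
  have hB0 : B ≠ 0 := fun h => by simp [h] at hBre; exact hε.ne hBre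
  have hb1 : 0 < (Real.pi * B : ℂ).re := by
    rw [Complex.re_ofReal_mul, hBre]
    positivity
  have hBA : B ^ 2 + (μ : ℂ) ^ 2 = ε * A := by
    rw [hA, hB]
    linear_combination (μ : ℂ) ^ 2 * Complex.I_sq
  have hb2 : 0 < (Real.pi * B + Real.pi * μ ^ 2 / B : ℂ).re := by
    have h : (Real.pi * μ ^ 2 / B : ℂ) = ((Real.pi * μ ^ 2 : ℝ) : ℂ) * B⁻¹ := by
      push_cast
      rw [div_eq_mul_inv]
    rw [Complex.add_re, h, Complex.re_ofReal_mul (Real.pi * μ ^ 2)]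
    exact add_pos_of_pos_of_nonneg hb1
      (mul_nonneg (by positivity) (re_inv_pos B (hBre.symm ▸ hε)).le)
  have hb2' : (Real.pi * B + Real.pi * μ ^ 2 / B : ℂ) = Real.pi * ε * A / B := by
    rw [mul_assoc, ← hBA]
    field_simp
  have hn : (Module.finrank ℝ (EuclideanSpace ℝ (Fin n)) : ℂ) = n := by simp
  have hF : ∀ ξ : EuclideanSpace ℝ (Fin n),
      𝓕 (fun x : EuclideanSpace ℝ (Fin n) => Complex.exp (-(Real.pi / A) * ‖x‖ ^ 2)) ξ =
        A ^ (n / 2 : ℂ) * Complex.exp (-(Real.pi * A) * ‖ξ‖ ^ 2) := by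
    intro ξ
    rw [fourier_gaussian_innerProductSpace hb, hn]
    congr 2 <;> field_simp
  have inner_int : ∀ ξ : EuclideanSpace ℝ (Fin n), (∫ η : EuclideanSpace ℝ (Fin n),
      A ^ (n / 2 : ℂ) * Complex.exp (-(Real.pi * A) * ‖ξ‖ ^ 2) *
      (A ^ (n / 2 : ℂ) * Complex.exp (-(Real.pi * A) * ‖η‖ ^ 2)) *
      quadraticSymbol n (Real.pi * μ) ξ η *
      Complex.exp (2 * (Real.pi : ℂ) * Complex.I * ((inner ℝ x (ξ + η) : ℝ) : ℂ))) =
      (A ^ (n / 2 : ℂ)) ^ 2 * (1 / B) ^ (n / 2 : ℂ) * Complex.exp (-(Real.pi / B) * ‖x‖ ^ 2) *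
      Complex.exp (-(Real.pi * B + Real.pi * μ ^ 2 / B) * ‖ξ‖ ^ 2 +
        (2 * Real.pi * Complex.I + 2 * Real.pi * μ / B) * ((inner ℝ x ξ : ℝ) : ℂ)) := by
    intro ξ
    have h : ∀ η : EuclideanSpace ℝ (Fin n),
        A ^ (n / 2 : ℂ) * Complex.exp (-(Real.pi * A) * ‖ξ‖ ^ 2) *
        (A ^ (n / 2 : ℂ) * Complex.exp (-(Real.pi * A) * ‖η‖ ^ 2)) *
        quadraticSymbol n (Real.pi * μ) ξ η *
        Complex.exp (2 * (Real.pi : ℂ) * Complex.I * ((inner ℝ x (ξ + η) : ℝ) : ℂ)) =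
        (A ^ (n / 2 : ℂ)) ^ 2 * Complex.exp (-(Real.pi * B) * ‖ξ‖ ^ 2 +
          2 * Real.pi * Complex.I * ((inner ℝ x ξ : ℝ) : ℂ)) *
        Complex.exp (-(Real.pi * B) * ‖η‖ ^ 2 +
          2 * Real.pi * Complex.I * ((inner ℝ (x - μ • ξ) η : ℝ) : ℂ)) := by
      intro η
      rw [quadraticSymbol, mul_mul_mul_comm, ← sq]
      simp only [mul_assoc ((A ^ (n / 2 : ℂ)) ^ 2), ← Complex.exp_add]
      congr 2
      rw [norm_sub_sq_real, inner_add_right, inner_sub_left, real_inner_smul_left, hA, hB]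
      push_cast
      ring
    have hsq : ‖x - μ • ξ‖ ^ 2 = ‖x‖ ^ 2 - 2 * μ * inner ℝ x ξ + μ ^ 2 * ‖ξ‖ ^ 2 := by
      rw [norm_sub_sq_real, norm_smul, real_inner_smul_right, mul_pow, Real.norm_eq_abs, sq_abs]
      ring
    simp_rw [h]
    rw [integral_const_mul, GaussianFourier.integral_cexp_neg_mul_sq_norm_add hb1, hn,
      ← Complex.ofReal_pow ‖x - μ • ξ‖, hsq]
    have hc : (Real.pi / (Real.pi * B) : ℂ) = 1 / B := by field_simp
    rw [hc, mul_assoc, mul_left_comm _ ((1 / B) ^ (n / 2 : ℂ)), ← Complex.exp_add,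
      mul_assoc _ _ (Complex.exp _), mul_assoc _ _ (Complex.exp _ * _), ← Complex.exp_add]
    congr 3
    push_cast
    field_simp
    linear_combination (4 : ℂ) * (‖x‖ ^ 2 - 2 * μ * (inner ℝ x ξ : ℝ) + μ ^ 2 * ‖ξ‖ ^ 2) *
      Complex.I_sq
  have value : bilinearMultiplierOp (quadraticSymbol n (Real.pi * μ))
      (fun x => Complex.exp (-(Real.pi / A) * ‖x‖ ^ 2))
      (fun x => Complex.exp (-(Real.pi / A) * ‖x‖ ^ 2)) x =
      (A ^ (n / 2 : ℂ)) ^ 2 * (1 / B) ^ (n / 2 : ℂ) * (B / (ε * A)) ^ (n / 2 : ℂ) *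
      Complex.exp (-(2 * (Real.pi / A)) * ‖x‖ ^ 2) := by
    rw [bilinearMultiplierOp]
    simp_rw [hF, inner_int]
    rw [integral_const_mul, GaussianFourier.integral_cexp_neg_mul_sq_norm_add hb2, hn, hb2']
    have hc : (Real.pi / (Real.pi * ε * A / B) : ℂ) = B / (ε * A) := by field_simp
    rw [hc, mul_assoc, mul_left_comm (Complex.exp _), ← Complex.exp_add, ← mul_assoc]
    congr 2
    have hmB : (μ : ℂ) = -Complex.I * (B - ε) := by
      rw [hB]
      linear_combination (μ : ℂ) * Complex.I_sq
    have hc2 : (2 * Real.pi * Complex.I + 2 * Real.pi * μ / B : ℂ) =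
        2 * Real.pi * Complex.I * ε / B := by
      rw [hmB]
      field_simp
      ring
    have hAB : A = 2 * B - ε := by
      rw [hA, hB]
      ring
    rw [hc2]
    have h3 : (2 * Real.pi * Complex.I * ε / B : ℂ) ^ 2 = -(4 * Real.pi ^ 2 * ε ^ 2 / B ^ 2) := by
      rw [div_pow, mul_pow, mul_pow, Complex.I_sq, mul_pow]
      ring
    rw [h3]
    field_simp
    rw [hAB]
    ring
  -- The exponent is real, so taking norms removes any choice of branch in the complex powers, and
  -- the powers of `‖B‖` cancel.
  have hnc : (n / 2 : ℂ) = ((n / 2 : ℝ) : ℂ) := by push_cast; rfl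
  rw [value, norm_mul, norm_mul, norm_mul, norm_pow, hnc]
  simp only [Complex.norm_cpow_real, norm_div, norm_mul, norm_one, Complex.norm_real]
  rw [Real.norm_of_nonneg hε.le]
  congr 1
  have hA1 : 0 < ‖A‖ := norm_pos_iff.2 hA0
  have hB1 : 0 < ‖B‖ := norm_pos_iff.2 hB0
  rw [sq, ← Real.mul_rpow (by positivity) (by positivity),
    ← Real.mul_rpow (by positivity) (by positivity),
    ← Real.mul_rpow (by positivity) (by positivity)]
  congr 1
  field_simp

/-! ### Scaling of Gaussian norms and the resulting bound. -/

theorem eLpNorm_gaussian_ne_top {n : ℕ} (p : ℝ≥0∞) {b : ℂ} (hb : 0 < b.re) :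
    eLpNorm (fun x : EuclideanSpace ℝ (Fin n) => Complex.exp (-b * ‖x‖ ^ 2)) p volume ≠ ⊤ :=
  ((gaussianSchwartz b hb).memLp p volume).eLpNorm_ne_top

theorem eLpNorm_gaussian_ne_zero {n : ℕ} {p : ℝ≥0∞} (hp : p ≠ 0) (b : ℂ) :
    eLpNorm (fun x : EuclideanSpace ℝ (Fin n) => Complex.exp (-b * ‖x‖ ^ 2)) p volume ≠ 0 := by
  intro h
  have hm : Continuous fun x : EuclideanSpace ℝ (Fin n) => Complex.exp (-b * ‖x‖ ^ 2) := by
    fun_prop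
  rw [eLpNorm_eq_zero_iff hm.aestronglyMeasurable hp] at h
  obtain ⟨x, hx⟩ := h.exists
  exact Complex.exp_ne_zero _ hx

/-- If `Re b = k c²`, the `Lᵖ` norms of the Gaussians with coefficients `b` and `k` differ by
the dilation factor of `x ↦ c x`. -/
theorem eLpNorm_gaussian_eq {n : ℕ} (p : ℝ≥0∞) (b : ℂ) (k c : ℝ) (hc : 0 < c)
    (hbc : b.re = k * c ^ 2) :
    eLpNorm (fun x : EuclideanSpace ℝ (Fin n) => Complex.exp (-b * ‖x‖ ^ 2)) p volume =
      ENNReal.ofReal |(c ^ n)⁻¹| ^ (1 / p).toReal *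
      eLpNorm (fun x : EuclideanSpace ℝ (Fin n) => Complex.exp (-(k : ℂ) * ‖x‖ ^ 2)) p volume := by
  have h := eLpNorm_comp_smul_eq (volume : Measure (EuclideanSpace ℝ (Fin n)))
    (fun x => Complex.exp (-(k : ℂ) * ‖x‖ ^ 2)) p hc.ne'
  rw [finrank_euclideanSpace_fin] at h
  rw [← h]
  refine eLpNorm_congr_norm_ae (ae_of_all _ fun x => ?_)
  rw [norm_cexp_mul_norm_sq, norm_cexp_mul_norm_sq, norm_smul, Real.norm_of_nonneg hc.le,
    Complex.neg_re, Complex.neg_re, Complex.ofReal_re, hbc]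
  congr 1
  ring

/-- Testing a bilinear multiplier inequality on chirped Gaussians. -/
theorem quadraticSymbol_gaussian_bound {n : ℕ} {p q r : ℝ≥0∞} (hp : p ≠ 0) (hq : q ≠ 0)
    (hpqr : 1 / p + 1 / q = 1 / r) {μ : ℝ} {C : ℝ≥0}
    (hC : ∀ f g : 𝓢(EuclideanSpace ℝ (Fin n), ℂ),
      eLpNorm (bilinearMultiplierOp (quadraticSymbol n (Real.pi * μ)) f g) r volume ≤
        (C : ℝ≥0∞) * eLpNorm f p volume * eLpNorm g q volume) {ε : ℝ} (hε : 0 < ε) :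
    ENNReal.ofReal ((‖(ε + 2 * μ * Complex.I : ℂ)‖ / ε) ^ (n / 2 : ℝ)) *
      eLpNorm (fun x : EuclideanSpace ℝ (Fin n) =>
        Complex.exp (-((2 * Real.pi : ℝ) : ℂ) * ‖x‖ ^ 2)) r volume ≤
      C * eLpNorm (fun x : EuclideanSpace ℝ (Fin n) =>
        Complex.exp (-(Real.pi : ℂ) * ‖x‖ ^ 2)) p volume *
      eLpNorm (fun x : EuclideanSpace ℝ (Fin n) =>
        Complex.exp (-(Real.pi : ℂ) * ‖x‖ ^ 2)) q volume := by
  set A : ℂ := ε + 2 * μ * Complex.I with hA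
  have hAre : A.re = ε := by simp [hA]
  have hA0 : A ≠ 0 := fun h => by simp [h] at hAre; exact hε.ne hAre
  have hA1 : 0 < ‖A‖ := norm_pos_iff.2 hA0
  -- Chosen so that `Re (π/A) = π ε/|A|² = π c²`.
  set c : ℝ := Real.sqrt ε / ‖A‖ with hcdef
  have hc : 0 < c := div_pos (Real.sqrt_pos.2 hε) hA1
  have hre : (Real.pi / A : ℂ).re = Real.pi * c ^ 2 := by
    rw [div_eq_mul_inv, Complex.re_ofReal_mul, Complex.inv_re, hAre, Complex.normSq_eq_norm_sq,
      hcdef, div_pow, Real.sq_sqrt hε.le]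
  have hre2 : (2 * (Real.pi / A) : ℂ).re = 2 * Real.pi * c ^ 2 := by
    have := Complex.re_ofReal_mul 2 (Real.pi / A : ℂ)
    rw [hre, Complex.ofReal_ofNat] at this
    rw [this]
    ring
  have hb : 0 < (Real.pi / A : ℂ).re := by
    rw [hre]
    have := Real.pi_pos
    positivity
  have h := hC (gaussianSchwartz _ hb) (gaussianSchwartz _ hb)
  simp only [coe_gaussianSchwartz] at h
  have hK : 0 ≤ (‖A‖ / ε) ^ (n / 2 : ℝ) := by positivity
  have hM : eLpNorm (bilinearMultiplierOp (quadraticSymbol n (Real.pi * μ))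
      (fun x => Complex.exp (-(Real.pi / A) * ‖x‖ ^ 2))
      (fun x => Complex.exp (-(Real.pi / A) * ‖x‖ ^ 2))) r volume =
      ENNReal.ofReal ((‖A‖ / ε) ^ (n / 2 : ℝ)) * eLpNorm (fun x : EuclideanSpace ℝ (Fin n) =>
        Complex.exp (-(2 * (Real.pi / A)) * ‖x‖ ^ 2)) r volume := by
    rw [← Real.enorm_eq_ofReal hK, ← eLpNorm_const_smul]
    refine eLpNorm_congr_norm_ae (ae_of_all _ fun x => ?_)
    rw [norm_bilinearMultiplierOp_quadraticSymbol_gaussian n ε μ hε A hA, Pi.smul_apply, norm_smul,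
      Real.norm_of_nonneg hK]
  rw [hM, eLpNorm_gaussian_eq r _ _ c hc hre2, eLpNorm_gaussian_eq p _ _ c hc hre,
    eLpNorm_gaussian_eq q _ _ c hc hre, ← hpqr,
    ENNReal.toReal_add (by simpa using hp) (by simpa using hq)] at h
  set D := ENNReal.ofReal |(c ^ n)⁻¹| with hD
  have hD0 : D ≠ 0 := by simp [hD, hc.ne']
  have hDt : D ≠ ⊤ := ENNReal.ofReal_ne_top
  -- The factor `D^(1/p + 1/q)` on the left now splits to match those of `f` and `g` on the right.
  rw [ENNReal.rpow_add _ _ hD0 hDt] at h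
  have hp0 : D ^ (1 / p).toReal ≠ 0 := by simp [ENNReal.rpow_eq_zero_iff, hD0, hDt]
  have hq0 : D ^ (1 / q).toReal ≠ 0 := by simp [ENNReal.rpow_eq_zero_iff, hD0, hDt]
  have hpt : D ^ (1 / p).toReal ≠ ⊤ := ENNReal.rpow_ne_top_of_nonneg (by positivity) hDt
  have hqt : D ^ (1 / q).toReal ≠ ⊤ := ENNReal.rpow_ne_top_of_nonneg (by positivity) hDt
  rw [← ENNReal.mul_le_mul_iff_right (mul_ne_zero hp0 hq0) (ENNReal.mul_ne_top hpt hqt)]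
  calc _ = _ := by ring
    _ ≤ _ := h
    _ = _ := by ring

/-! ### Letting `ε` tend to zero. -/

theorem mainTheorem5 (n : ℕ) (hn : 1 ≤ n) (p q r : ENNReal) (hpqr : InLocalL2Range p q r)
    (lam : ℝ) (hlam : lam ≠ 0) :
    ¬ IsBilinearMultiplier (quadraticSymbol n lam) p q r := by
  rintro ⟨-, -, C, hC⟩
  obtain ⟨hp, hq, -, hsum⟩ := hpqr
  have hp0 : p ≠ 0 := (lt_of_lt_of_le (by norm_num) hp).ne'
  have hq0 : q ≠ 0 := (lt_of_lt_of_le (by norm_num) hq).ne'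
  have hr0 : r ≠ 0 := by
    rintro rfl
    rw [ENNReal.div_zero one_ne_zero] at hsum
    exact ENNReal.add_ne_top.2 ⟨by simpa using hp0, by simpa using hq0⟩ hsum
  obtain ⟨μ, rfl⟩ : ∃ μ, lam = Real.pi * μ := ⟨lam / Real.pi, by field_simp⟩
  have hμ : 0 < |μ| := abs_pos.2 (right_ne_zero_of_mul hlam)
  have hbound := fun ε (hε : 0 < ε) => quadraticSymbol_gaussian_bound hp0 hq0 hsum hC (ε := ε) hε
  set X := eLpNorm (fun x : EuclideanSpace ℝ (Fin n) =>
        Complex.exp (-((2 * Real.pi : ℝ) : ℂ) * ‖x‖ ^ 2)) r volume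
  set Y := C * eLpNorm (fun x : EuclideanSpace ℝ (Fin n) =>
        Complex.exp (-(Real.pi : ℂ) * ‖x‖ ^ 2)) p volume *
      eLpNorm (fun x : EuclideanSpace ℝ (Fin n) =>
        Complex.exp (-(Real.pi : ℂ) * ‖x‖ ^ 2)) q volume
  have hX : X ≠ 0 := eLpNorm_gaussian_ne_zero hr0 _
  have hπ : 0 < (Real.pi : ℂ).re := Real.pi_pos
  have hY : Y ≠ ⊤ := ENNReal.mul_ne_top (ENNReal.mul_ne_top ENNReal.coe_ne_top
    (eLpNorm_gaussian_ne_top p hπ)) (eLpNorm_gaussian_ne_top q hπ)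
  obtain ⟨N, hN⟩ := ENNReal.exists_nat_mul_gt hX hY
  -- This `ε` makes `|A|/ε ≥ 2|μ|/ε = (N+1)²`; as `n ≥ 1`, its power `n/2` is at least `N + 1`,
  -- which contradicts `Y < N X`.
  refine absurd (hbound (2 * |μ| / (N + 1) ^ 2) (by positivity)) (not_le.2 (hN.trans_le ?_))
  gcongr
  rw [← ENNReal.ofReal_natCast]
  apply ENNReal.ofReal_le_ofReal
  set ε : ℝ := 2 * |μ| / (N + 1) ^ 2 with hε
  have hε0 : 0 < ε := by positivity
  have h1 : 2 * |μ| ≤ ‖(ε + 2 * μ * Complex.I : ℂ)‖ := by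
    refine le_trans (le_of_eq ?_) (Complex.abs_im_le_norm _)
    simp [abs_mul]
  have h2 : ((N : ℝ) + 1) ^ 2 ≤ ‖(ε + 2 * μ * Complex.I : ℂ)‖ / ε := by
    rw [le_div_iff₀ hε0, hε, mul_div_cancel₀ _ (by positivity)]
    exact h1
  have h3 : (1 : ℝ) ≤ ((N : ℝ) + 1) ^ 2 := one_le_pow₀ (by linarith [N.cast_nonneg (α := ℝ)])
  have h4 : (1 / 2 : ℝ) ≤ n / 2 := by
    have : (1 : ℝ) ≤ n := by exact_mod_cast hn
    linarith
  calc (N : ℝ) ≤ N + 1 := by linarith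
    _ = (((N : ℝ) + 1) ^ 2) ^ (1 / 2 : ℝ) := by
        rw [← Real.sqrt_eq_rpow, Real.sqrt_sq (by positivity)]
    _ ≤ (((N : ℝ) + 1) ^ 2) ^ (n / 2 : ℝ) := Real.rpow_le_rpow_of_exponent_le h3 h4
    _ ≤ _ := Real.rpow_le_rpow (by positivity) h2 (by positivity)
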